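/- Fix a finite set $A=\{1,\dots,n\}$ of agents and a finite or countable set $\mathsf{Prop}$ of atoms. A group is a non-empty subset of $A$. The language $\mathcal{L}_{\Box[\forall]_I}$ is given by $\varphi::=p\mid\neg\varphi\mid\varphi\wedge\varphi\mid\Box_I\varphi\mid[\forall]_I\varphi$, with $p\in\mathsf{Prop}$ and $I$ any group ($\varphi\to\psi$ abbreviates $\neg(\varphi\wedge\neg\psi)$). The fragment $\mathcal{L}_{\Box[\forall]_{i,A}}$ allows only the modalities whose group is a singleton $\{i\}$ or the full group $A$. A multi-agent topo-e-model consists of a set $X$ of states; for each agent $i$, a partition $\Pi_i$ of $X$ and a topology $\tau_i$ on $X$ with $\Pi_i\subseteq\tau_i$; and a valuation $[\![p]\!]\subseteq X$ for each $p\in\mathsf{Prop}$. Let $\Pi_i(x)$ be the cell of $\Pi_i$ that contains $x$. For a group $I$ put $\Pi_I(x)=\bigcap_{i\in I}\Pi_i(x)$, and let $\tau_I$ be the topology generated by $\bigcup_{i\in I}\tau_i$. Negation and conjunction are interpreted as complement and intersection, $[\![\Box_I\varphi]\!]$ is the interior of $[\![\varphi]\!]$ with respect to $\tau_I$, and $[\![[\forall]_I\varphi]\!]=\{x\in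 X:\Pi_I(x)\subseteq[\![\varphi]\!]\}$. A formula is valid if it is true at every state of every topo-e-model. The proof system $\boldsymbol{\Box[\forall]_I}$ consists of classical propositional logic (all instances of tautologies, modus ponens); the $\mathsf{S4}$ axioms and rules for each $\Box_I$ (K, T, 4, necessitation); the $\mathsf{S5}$ axioms and rules for each $[\forall]_I$ (K, T, 4, 5, necessitation); group monotonicity $\Box_J\varphi\to\Box_I\varphi$ and $[\forall]_J\varphi\to[\forall]_I\varphi$ for groups $J\subseteq I$; and inclusion $[\forall]_I\varphi\to\Box_I\varphi$. The system $\boldsymbol{\Box[\forall]_{i,A}}$ is obtained by restricting all axioms and rules to $\mathcal{L}_{\Box[\forall]_{i,A}}$. **Theorem.** (1) The system $\boldsymbol{\Box[\forall]_I}$ is sound and (weakly) complete for topo-e-models: a formula of $\mathcal{L}_{\Box[\forall]_I}$ is provable if and only if it is valid. Moreover the logic is decidable: for any effective coding of the atoms, the set of (Gödel numbers of) valid formulas of $\mathcal{L}_{\Box[\forall]_I}$ is recursive. (2) The same holds for the system $\boldsymbol{\Box[\forall]_{i,A}}$ and the fragment $\mathcal{L}_{\Box[\forall]_{i,A}}$: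 a formula of the fragment is provable in $\boldsymbol{\Box[\forall]_{i,A}}$ if and only if it is valid, and the set of valid formulas of the fragment is decidable. -/

import Mathlib

universe u v

namespace GroupEvidence

open scoped Topology

/-- Groups of agents: the non-empty subsets of the finite set `Fin n` of agents. -/
abbrev AgentGroup (n : ℕ) : Type := {I : Finset (Fin n) // I.Nonempty}

/-- Every group may label a modality: this gives the full language of group evidence. -/
def allGroups (n : ℕ) : Set (AgentGroup n) := Set.univ

/-- Only the individual agents (singleton groups) and the full group may label a modality. -/
def individualsAndFull (n : ℕ) : Set (AgentGroup n) :=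
  {I | (∃ i : Fin n, I.1 = {i}) ∨ I.1 = Finset.univ}

/-- Formulas over the atoms `Atom`, with a soft evidence modality `□_I` (`box I`) and a
hard evidence modality `[∀]_I` (`all I`) for each group `I` in the set `S` of labels. -/
inductive Formula {n : ℕ} (S : Set (AgentGroup n)) (Atom : Type v) : Type v
  | atom (p : Atom) : Formula S Atom
  | neg (φ : Formula S Atom) : Formula S Atom
  | and (φ ψ : Formula S Atom) : Formula S Atom
  | box (I : S) (φ : Formula S Atom) : Formula S Atom
  | all (I : S) (φ : Formula S Atom) : Formula S Atom

/-- Material implication, as the usual abbreviation `¬ (φ ∧ ¬ ψ)`. -/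
def Formula.imp {n : ℕ} {S : Set (AgentGroup n)} {Atom : Type v}
    (φ ψ : Formula S Atom) : Formula S Atom :=
  .neg (.and φ (.neg ψ))

/-- Multi-agent topological evidence models for `n` agents. -/
structure TopoEModel (n : ℕ) (Atom : Type v) where
  /-- states -/
  X : Type u
  /-- the information partition of each agent, as a family of cells -/
  cells : Fin n → Set (Set X)
  isPartition : ∀ i, Setoid.IsPartition (cells i)
  /-- the evidential topology of each agent -/
  top : Fin n → TopologicalSpace X
  /-- hard evidence is evidence: the partition cells are open -/
  cells_open : ∀ i, ∀ C ∈ cells i, IsOpen[top i] C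
  /-- valuation -/
  val : Atom → Set X

namespace TopoEModel

variable {n : ℕ} {Atom : Type v} (M : TopoEModel.{u, v} n Atom)

/-- `Π_i(x)`: the cell of agent `i`'s partition that contains `x`. -/
def cell (i : Fin n) (x : M.X) : Set M.X := {y | ∃ C ∈ M.cells i, x ∈ C ∧ y ∈ C}

/-- `Π_I(x)`: the hard evidence of the group `I` at `x`. -/
def groupCell (I : AgentGroup n) (x : M.X) : Set M.X := ⋂ i ∈ I.1, M.cell i x

/-- `τ_I`: the join topology of the group `I`, generated by the evidence of all its members. -/
abbrev groupTop (I : AgentGroup n) : TopologicalSpace M.X :=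
  TopologicalSpace.generateFrom (⋃ i ∈ I.1, {U | IsOpen[M.top i] U})

/-- The group operator `□_I`: interior with respect to `τ_I`. -/
def softEvidence (I : AgentGroup n) (P : Set M.X) : Set M.X :=
  {x | ∃ U, IsOpen[M.groupTop I] U ∧ x ∈ U ∧ U ⊆ P}

/-- The group operator `[∀]_I`. -/
def hardEvidence (I : AgentGroup n) (P : Set M.X) : Set M.X := {x | M.groupCell I x ⊆ P}

/-- The interpretation of formulas as sets of states. -/
def interp {S : Set (AgentGroup n)} : Formula S Atom → Set M.X
  | .atom p => M.val p
  | .neg φ => (interp φ)ᶜ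
  | .and φ ψ => interp φ ∩ interp ψ
  | .box I φ => M.softEvidence I.1 (interp φ)
  | .all I φ => M.hardEvidence I.1 (interp φ)

end TopoEModel

/-- Validity: truth at every state of every topo-e-model. -/
def Valid {n : ℕ} {S : Set (AgentGroup n)} {Atom : Type v} (φ : Formula S Atom) : Prop :=
  ∀ (M : TopoEModel.{u, v} n Atom) (x : M.X), x ∈ M.interp φ

/-- Substitution instances of propositional tautologies: formulas that are true under every
assignment of truth values to formulas which respects negation and conjunction. -/
def Tautology {n : ℕ} {S : Set (AgentGroup n)} {Atom : Type v} (φ : Formula S Atom) : Prop :=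
  ∀ t : Formula S Atom → Prop,
    (∀ ψ, t (.neg ψ) ↔ ¬ t ψ) → (∀ ψ χ, t (.and ψ χ) ↔ t ψ ∧ t χ) → t φ

/-- Theorems of the proof system with modalities labelled by the groups in `S`. All formulas
of a derivation lie in the language with labels in `S`. -/
inductive Provable {n : ℕ} {S : Set (AgentGroup n)} {Atom : Type v} : Formula S Atom → Prop
  /- classical propositional logic -/
  | taut {φ : Formula S Atom} (h : Tautology φ) : Provable φ
  | mp {φ ψ : Formula S Atom} (h₁ : Provable (φ.imp ψ)) (h₂ : Provable φ) : Provable ψ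
  /- S4 for `□_I` -/
  | box_K (I : S) (φ ψ : Formula S Atom) :
      Provable ((Formula.box I (φ.imp ψ)).imp ((Formula.box I φ).imp (.box I ψ)))
  | box_T (I : S) (φ : Formula S Atom) : Provable ((Formula.box I φ).imp φ)
  | box_4 (I : S) (φ : Formula S Atom) :
      Provable ((Formula.box I φ).imp (.box I (.box I φ)))
  | box_nec (I : S) {φ : Formula S Atom} (h : Provable φ) : Provable (.box I φ)
  /- S5 for `[∀]_I` -/
  | all_K (I : S) (φ ψ : Formula S Atom) :
      Provable ((Formula.all I (φ.imp ψ)).imp ((Formula.all I φ).imp (.all I ψ)))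
  | all_T (I : S) (φ : Formula S Atom) : Provable ((Formula.all I φ).imp φ)
  | all_4 (I : S) (φ : Formula S Atom) :
      Provable ((Formula.all I φ).imp (.all I (.all I φ)))
  | all_5 (I : S) (φ : Formula S Atom) :
      Provable ((Formula.neg (.all I φ)).imp (.all I (.neg (.all I φ))))
  | all_nec (I : S) {φ : Formula S Atom} (h : Provable φ) : Provable (.all I φ)
  /- group monotonicity -/
  | box_mono (J I : S) (h : J.1.1 ⊆ I.1.1) (φ : Formula S Atom) :
      Provable ((Formula.box J φ).imp (.box I φ))
  | all_mono (J I : S) (h : J.1.1 ⊆ I.1.1) (φ : Formula S Atom) :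
      Provable ((Formula.all J φ).imp (.all I φ))
  /- inclusion -/
  | incl (I : S) (φ : Formula S Atom) : Provable ((Formula.all I φ).imp (.box I φ))

/-- The number of a group: the binary number whose digit at position `i` says whether agent `i`
is a member. -/
def groupCode {n : ℕ} (I : AgentGroup n) : ℕ := ∑ i ∈ I.1, 2 ^ (i : ℕ)

/-- Gödel numbers of formulas, over effectively coded atoms. -/
def Formula.code {n : ℕ} {S : Set (AgentGroup n)} {Atom : Type v} [Primcodable Atom] :
    Formula S Atom → ℕ
  | .atom p => Nat.pair 0 (Encodable.encode p)
  | .neg φ => Nat.pair 1 φ.code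
  | .and φ ψ => Nat.pair 2 (Nat.pair φ.code ψ.code)
  | .box I φ => Nat.pair 3 (Nat.pair (groupCode I.1) φ.code)
  | .all I φ => Nat.pair 4 (Nat.pair (groupCode I.1) φ.code)

theorem groupCode_injective {n : ℕ} : Function.Injective (groupCode (n := n)) := by
  intro I J h
  have key : ∀ K : AgentGroup n, groupCode K = ∑ k ∈ K.1.map Fin.valEmbedding, 2 ^ k := by
    intro K
    simp [groupCode]
  rw [key, key] at h
  exact Subtype.ext (Finset.map_injective _ (Finset.equivBitIndices.symm.injective h))

/-- Distinct formulas have distinct Gödel numbers. -/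
theorem Formula.code_injective {n : ℕ} {S : Set (AgentGroup n)} {Atom : Type v}
    [Primcodable Atom] : Function.Injective (Formula.code (S := S) (Atom := Atom)) := by
  intro φ
  induction φ with
  | atom p => intro ψ h; cases ψ <;> simp [Formula.code] at h ⊢; exact h
  | neg φ ih => intro ψ h; cases ψ <;> simp [Formula.code] at h ⊢; exact ih h
  | and φ χ ih₁ ih₂ =>
    intro ψ h
    cases ψ <;> simp [Formula.code] at h ⊢
    exact ⟨ih₁ h.1, ih₂ h.2⟩
  | box I φ ih =>
    intro ψ h
    cases ψ <;> simp [Formula.code] at h ⊢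
    exact ⟨Subtype.ext (groupCode_injective h.1), ih h.2⟩
  | all I φ ih =>
    intro ψ h
    cases ψ <;> simp [Formula.code] at h ⊢
    exact ⟨Subtype.ext (groupCode_injective h.1), ih h.2⟩

/-- A set of formulas is decidable if the set of the Gödel numbers of its members is recursive. -/
def DecidableLogic {n : ℕ} {S : Set (AgentGroup n)} {Atom : Type v} [Primcodable Atom]
    (L : Set (Formula S Atom)) : Prop :=
  ComputablePred fun k : ℕ => ∃ φ ∈ L, Formula.code φ = k

/-- The logic of topo-e-models in the language with labels in `S`: the set of valid formulas. -/
def logic {n : ℕ} (S : Set (AgentGroup n)) (Atom : Type v) : Set (Formula S Atom) :=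
  {φ | Valid.{u, v} φ}

end GroupEvidence

/-!
Everything is proved for an arbitrary set `S` of labels; the full language and the fragment are the
two instances.

*Completeness.* The canonical model of maximal theories gives relations for `□_I` and `[∀]_I`, but
its relation for a group need not be the intersection of the relations of the members, as the
topological semantics demands. Filtering the model through a finite set `Sig` of formulas gives a
finite structure with preorders `SoftRel Sig I` and equivalence relations `HardRel Sig I` that are
antitone in `I` (`isHintikka_isMaximal`). It is unravelled into the forest of histories, where every
step carries a label `I` and counts for all members of `I` at once. As paths in a forest are unique,
two histories that are linked for each member of `I` separately are linked by steps whose labels all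
include `I`, and antitonicity makes their last states related for `I` (`hardRel_of_top_eq`,
`softRel_of_reflTransGen`). With the sets closed under the steps of agent `i` as its open sets, the
least neighbourhood of a history in the join topology is the intersection of the individual ones,
because groups are finite; hence the truth lemma `mem_interp_unravelling`. Only the labels in `S`
are needed for this, so that the argument does not depend on which groups belong to the language.

*Decidability.* Let `N` exceed the Gödel number of `φ`, and let `Sig` consist of the formulas with
Gödel numbers below `N`. A subset of `Sig` is a number below `2 ^ N` through its binary digits, and
a family of such subsets is a number below `2 ^ 2 ^ N`. By the above, `φ` is not valid if and only
if one of the latter numbers codes a family that satisfies the truth conditions for `Sig` and has a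
member without `φ` (`IsCodeMask.not_valid`, `IsCodeMask.refutable`). All quantifiers in this
condition are bounded, so it is primitive recursive. The Gödel numbers below `N` are themselves
recognized by a bounded search for the number whose digits mark them (`IsCodeMask`).
-/

namespace GroupEvidence

open scoped Topology

variable {n : ℕ} {S : Set (AgentGroup n)} {Atom : Type v}

/-! ### Soundness -/

namespace TopoEModel

variable (M : TopoEModel.{u, v} n Atom)

theorem self_mem_cell (i : Fin n) (x : M.X) : x ∈ M.cell i x := by
  obtain ⟨C, ⟨hC, hx⟩, -⟩ := (M.isPartition i).2 x
  exact ⟨C, hC, hx, hx⟩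

theorem cell_eq_of_mem {i : Fin n} {x y : M.X} (h : y ∈ M.cell i x) :
    M.cell i y = M.cell i x := by
  obtain ⟨C, hC, hx, hy⟩ := h
  have key : ∀ z, z ∈ C → M.cell i z = C := by
    intro z hz
    ext w
    constructor
    · rintro ⟨D, hD, hzD, hwD⟩
      rwa [((M.isPartition i).2 z).unique ⟨hC, hz⟩ ⟨hD, hzD⟩]
    · exact fun hw => ⟨C, hC, hz, hw⟩
  rw [key x hx, key y hy]

theorem isOpen_cell (i : Fin n) (x : M.X) : IsOpen[M.top i] (M.cell i x) := by
  have : M.cell i x = ⋃₀ {C | C ∈ M.cells i ∧ x ∈ C} := by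
    ext y
    simp [cell, and_assoc]
  rw [this]
  exact @isOpen_sUnion _ (M.top i) _ fun C hC => M.cells_open i C hC.1

theorem self_mem_groupCell (I : AgentGroup n) (x : M.X) : x ∈ M.groupCell I x :=
  Set.mem_iInter₂.2 fun i _ => M.self_mem_cell i x

theorem groupCell_eq_of_mem {I : AgentGroup n} {x y : M.X} (h : y ∈ M.groupCell I x) :
    M.groupCell I y = M.groupCell I x :=
  Set.iInter₂_congr fun i hi => M.cell_eq_of_mem (Set.mem_iInter₂.1 h i hi)

theorem groupCell_anti {I J : AgentGroup n} (h : J.1 ⊆ I.1) (x : M.X) :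
    M.groupCell I x ⊆ M.groupCell J x :=
  Set.biInter_subset_biInter_left h

theorem isOpen_groupTop_of_isOpen {I : AgentGroup n} {i : Fin n} (hi : i ∈ I.1) {U : Set M.X}
    (hU : IsOpen[M.top i] U) : IsOpen[M.groupTop I] U :=
  .basic _ (Set.mem_iUnion₂.2 ⟨i, hi, hU⟩)

theorem groupTop_anti {I J : AgentGroup n} (h : J.1 ⊆ I.1) : M.groupTop I ≤ M.groupTop J :=
  TopologicalSpace.generateFrom_anti (Set.biUnion_subset_biUnion_left h)

/-- Joint hard evidence is evidence of the group; this needs the group to be finite. -/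
theorem isOpen_groupCell (I : AgentGroup n) (x : M.X) : IsOpen[M.groupTop I] (M.groupCell I x) :=
  @isOpen_biInter_finset _ _ (M.groupTop I) I.1 _ fun i hi =>
    M.isOpen_groupTop_of_isOpen hi (M.isOpen_cell i x)

theorem mem_interp_imp {φ ψ : Formula S Atom} {x : M.X} :
    x ∈ M.interp (φ.imp ψ) ↔ (x ∈ M.interp φ → x ∈ M.interp ψ) := by
  simp [Formula.imp, interp]

end TopoEModel

theorem Provable.valid {φ : Formula S Atom} (h : Provable φ) : Valid.{u, v} φ := by
  intro M
  induction h with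
  | taut h =>
    intro x
    exact h (fun ψ => x ∈ M.interp ψ) (fun ψ => Iff.rfl) (fun ψ χ => Iff.rfl)
  | mp _ _ ih₁ ih₂ => exact fun x => M.mem_interp_imp.1 (ih₁ x) (ih₂ x)
  | box_K I φ ψ =>
    intro x
    simp only [M.mem_interp_imp]
    rintro ⟨U, hU, hxU, hUP⟩ ⟨V, hV, hxV, hVP⟩
    exact ⟨U ∩ V, @IsOpen.inter _ (M.groupTop I.1) _ _ hU hV, ⟨hxU, hxV⟩,
      fun y hy => M.mem_interp_imp.1 (hUP hy.1) (hVP hy.2)⟩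
  | box_T I φ =>
    intro x
    rw [M.mem_interp_imp]
    rintro ⟨U, hU, hxU, hUP⟩
    exact hUP hxU
  | box_4 I φ =>
    intro x
    rw [M.mem_interp_imp]
    rintro ⟨U, hU, hxU, hUP⟩
    exact ⟨U, hU, hxU, fun y hy => ⟨U, hU, hy, hUP⟩⟩
  | box_nec I _ ih =>
    exact fun x => ⟨Set.univ, @isOpen_univ _ (M.groupTop I.1), trivial, fun y _ => ih y⟩
  | all_K I φ ψ =>
    intro x
    simp only [M.mem_interp_imp]
    exact fun h₁ h₂ y hy => M.mem_interp_imp.1 (h₁ hy) (h₂ hy)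
  | all_T I φ =>
    intro x
    rw [M.mem_interp_imp]
    exact fun h => h (M.self_mem_groupCell I.1 x)
  | all_4 I φ =>
    intro x
    rw [M.mem_interp_imp]
    intro h y hy
    exact (M.groupCell_eq_of_mem hy).subset.trans h
  | all_5 I φ =>
    intro x
    rw [M.mem_interp_imp]
    intro h y hy h'
    exact h ((M.groupCell_eq_of_mem hy).superset.trans h')
  | all_nec I _ ih => exact fun x y _ => ih y
  | box_mono J I h φ =>
    intro x
    rw [M.mem_interp_imp]
    rintro ⟨U, hU, hxU, hUP⟩
    exact ⟨U, M.groupTop_anti h U hU, hxU, hUP⟩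
  | all_mono J I h φ =>
    intro x
    rw [M.mem_interp_imp]
    exact fun h' => (M.groupCell_anti h x).trans h'
  | incl I φ =>
    intro x
    rw [M.mem_interp_imp]
    exact fun h => ⟨_, M.isOpen_groupCell I.1 x, M.self_mem_groupCell I.1 x, h⟩

/-! ### Theories and maximal consistency -/

/-- A theory: a set of formulas that contains all theorems and is closed under modus ponens.
It need not be closed under necessitation. -/
structure IsTheory (T : Set (Formula S Atom)) : Prop where
  provable : ∀ {φ}, Provable φ → φ ∈ T
  mp : ∀ {φ ψ}, φ.imp ψ ∈ T → φ ∈ T → ψ ∈ T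

/-- A maximal consistent theory, given as a theory that decides every formula. -/
structure IsMaximal (T : Set (Formula S Atom)) : Prop extends IsTheory T where
  neg_mem : ∀ φ, φ.neg ∈ T ↔ φ ∉ T

theorem imp_tautology_iff {t : Formula S Atom → Prop} (hn : ∀ ψ, t (.neg ψ) ↔ ¬ t ψ)
    (ha : ∀ ψ χ, t (.and ψ χ) ↔ t ψ ∧ t χ) (φ ψ : Formula S Atom) :
    t (φ.imp ψ) ↔ (t φ → t ψ) := by
  simp [Formula.imp, hn, ha]

namespace IsTheory

variable {T : Set (Formula S Atom)}

theorem mp_provable (hT : IsTheory T) {φ ψ : Formula S Atom} (h : Provable (φ.imp ψ))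
    (hφ : φ ∈ T) : ψ ∈ T :=
  hT.mp (hT.provable h) hφ

/-- The deduction theorem: the formulas that follow from `φ` over a theory form a theory. -/
theorem adjoin (hT : IsTheory T) (φ : Formula S Atom) : IsTheory {ψ | φ.imp ψ ∈ T} where
  provable {ψ} h := hT.mp_provable (.taut fun t hn ha => by
    simp only [imp_tautology_iff hn ha]; tauto) (hT.provable h)
  mp {ψ χ} h₁ h₂ := hT.mp (hT.mp_provable (.taut fun t hn ha => by
    simp only [imp_tautology_iff hn ha]; tauto) h₁) h₂

theorem setOf_box_mem (hT : IsTheory T) (I : S) : IsTheory {φ | Formula.box I φ ∈ T} where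
  provable h := hT.provable (.box_nec I h)
  mp {φ ψ} h₁ h₂ := hT.mp (hT.mp_provable (.box_K I φ ψ) h₁) h₂

theorem setOf_all_mem (hT : IsTheory T) (I : S) : IsTheory {φ | Formula.all I φ ∈ T} where
  provable h := hT.provable (.all_nec I h)
  mp {φ ψ} h₁ h₂ := hT.mp (hT.mp_provable (.all_K I φ ψ) h₁) h₂

/-- Lindenbaum's lemma: a theory extends to a maximal one without a given non-member. -/
theorem exists_isMaximal (hT : IsTheory T) {φ : Formula S Atom} (hφ : φ ∉ T) :
    ∃ T', T ⊆ T' ∧ IsMaximal T' ∧ φ ∉ T' := by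
  obtain ⟨T', hTT', hmax⟩ := zorn_subset_nonempty {T' | IsTheory T' ∧ φ ∉ T'} (by
    intro c hc hchain ⟨T₀, hT₀⟩
    refine ⟨⋃₀ c, ⟨⟨fun h => ⟨T₀, hT₀, (hc hT₀).1.provable h⟩, ?_⟩, ?_⟩,
      fun s hs => Set.subset_sUnion_of_mem hs⟩
    · rintro ψ χ ⟨A, hA, h₁⟩ ⟨B, hB, h₂⟩
      obtain hAB | hBA := hchain.total hA hB
      · exact ⟨B, hB, (hc hB).1.mp (hAB h₁) h₂⟩
      · exact ⟨A, hA, (hc hA).1.mp h₁ (hBA h₂)⟩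
    · rintro ⟨A, hA, h⟩
      exact (hc hA).2 h) T ⟨hT, hφ⟩
  obtain ⟨hT', hφ'⟩ := hmax.prop
  have key : ∀ ψ, ψ ∉ T' → ψ.imp φ ∈ T' := by
    intro ψ hψ
    by_contra hcon
    refine hψ (hmax.le_of_ge ⟨hT'.adjoin ψ, hcon⟩ (fun χ hχ => ?_) ?_)
    · exact hT'.mp_provable (.taut fun t hn ha => by
        simp only [imp_tautology_iff hn ha]; tauto) hχ
    · exact hT'.provable (.taut fun t hn ha => by
        simp only [imp_tautology_iff hn ha]; tauto)
  refine ⟨T', hTT', ⟨hT', fun ψ => ⟨fun h₁ h₂ => hφ' ?_, fun h₁ => ?_⟩⟩, hφ'⟩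
  · exact hT'.mp (hT'.mp_provable (.taut fun t hn ha => by
      simp only [imp_tautology_iff hn ha, hn]; tauto) h₁) h₂
  · by_contra h₂
    exact hφ' (hT'.mp (hT'.mp_provable (.taut fun t hn ha => by
      simp only [imp_tautology_iff hn ha, hn]; tauto) (key _ h₁)) (key _ h₂))

end IsTheory

theorem isTheory_provable : IsTheory {φ : Formula S Atom | Provable φ} where
  provable h := h
  mp := .mp

theorem IsMaximal.and_mem {T : Set (Formula S Atom)} (hT : IsMaximal T) (φ ψ : Formula S Atom) :
    φ.and ψ ∈ T ↔ φ ∈ T ∧ ψ ∈ T := by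
  refine ⟨fun h => ⟨hT.mp_provable (.taut fun t hn ha => ?_) h,
    hT.mp_provable (.taut fun t hn ha => ?_) h⟩, fun h =>
    hT.mp (hT.mp_provable (.taut fun t hn ha => ?_) h.1) h.2⟩ <;>
  simp only [imp_tautology_iff hn ha, ha] <;> tauto

/-! ### Hintikka families -/

/-- The set `Sig` of formulas contains the immediate subformulas of its members. -/
structure SubformulaClosed (Sig : Set (Formula S Atom)) : Prop where
  neg : ∀ {φ}, Formula.neg φ ∈ Sig → φ ∈ Sig
  and_left : ∀ {φ ψ}, Formula.and φ ψ ∈ Sig → φ ∈ Sig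
  and_right : ∀ {φ ψ}, Formula.and φ ψ ∈ Sig → ψ ∈ Sig
  box : ∀ {I φ}, Formula.box I φ ∈ Sig → φ ∈ Sig
  all : ∀ {I φ}, Formula.all I φ ∈ Sig → φ ∈ Sig

/-- `T` and `T'` agree on the formulas `[∀]_J φ` of `Sig` with `J ⊆ I`: the equivalence relation
that interprets `[∀]_I` between sets of formulas. Quantifying over all `J ⊆ I` makes it shrink as
`I` grows. -/
def HardRel (Sig : Set (Formula S Atom)) (I : S) (T T' : Set (Formula S Atom)) : Prop :=
  ∀ J : S, J.1.1 ⊆ I.1.1 → ∀ φ, Formula.all J φ ∈ Sig →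
    (Formula.all J φ ∈ T ↔ Formula.all J φ ∈ T')

/-- The preorder that interprets `□_I` between sets of formulas: the formulas `□_J φ` of `Sig` with
`J ⊆ I` persist from `T` to `T'`, and `T` and `T'` are related by `HardRel Sig I`. -/
def SoftRel (Sig : Set (Formula S Atom)) (I : S) (T T' : Set (Formula S Atom)) : Prop :=
  (∀ J : S, J.1.1 ⊆ I.1.1 → ∀ φ, Formula.box J φ ∈ Sig →
    Formula.box J φ ∈ T → Formula.box J φ ∈ T') ∧
    HardRel Sig I T T'

section Rel

variable {Sig : Set (Formula S Atom)} {I J : S} {T T' T'' : Set (Formula S Atom)}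

theorem HardRel.refl : HardRel Sig I T T := fun _ _ _ _ => Iff.rfl

theorem HardRel.symm (h : HardRel Sig I T T') : HardRel Sig I T' T :=
  fun J hJ φ hφ => (h J hJ φ hφ).symm

theorem HardRel.trans (h : HardRel Sig I T T') (h' : HardRel Sig I T' T'') : HardRel Sig I T T'' :=
  fun J hJ φ hφ => (h J hJ φ hφ).trans (h' J hJ φ hφ)

theorem HardRel.anti (hJI : J.1.1 ⊆ I.1.1) (h : HardRel Sig I T T') : HardRel Sig J T T' :=
  fun K hK => h K (hK.trans hJI)

theorem SoftRel.refl : SoftRel Sig I T T := ⟨fun _ _ _ _ h => h, .refl⟩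

theorem SoftRel.trans (h : SoftRel Sig I T T') (h' : SoftRel Sig I T' T'') : SoftRel Sig I T T'' :=
  ⟨fun J hJ φ hφ hT => h'.1 J hJ φ hφ (h.1 J hJ φ hφ hT), h.2.trans h'.2⟩

theorem SoftRel.anti (hJI : J.1.1 ⊆ I.1.1) (h : SoftRel Sig I T T') : SoftRel Sig J T T' :=
  ⟨fun K hK => h.1 K (hK.trans hJI), h.2.anti hJI⟩

end Rel

/-- A Hintikka family for `Sig`: sets of formulas `V w`, indexed by the states `w` of a relational
structure with the relations `SoftRel Sig I` and `HardRel Sig I`, that satisfy the truth conditions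
of the formulas of `Sig`. -/
structure IsHintikka (Sig : Set (Formula S Atom)) {W : Type*} (V : W → Set (Formula S Atom)) :
    Prop where
  neg : ∀ w φ, Formula.neg φ ∈ Sig → (Formula.neg φ ∈ V w ↔ φ ∉ V w)
  and : ∀ w φ ψ, Formula.and φ ψ ∈ Sig → (Formula.and φ ψ ∈ V w ↔ φ ∈ V w ∧ ψ ∈ V w)
  box : ∀ w I φ, Formula.box I φ ∈ Sig →
    (Formula.box I φ ∈ V w ↔ ∀ w', SoftRel Sig I (V w) (V w') → φ ∈ V w')
  all : ∀ w I φ, Formula.all I φ ∈ Sig →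
    (Formula.all I φ ∈ V w ↔ ∀ w', HardRel Sig I (V w) (V w') → φ ∈ V w')

/-- Only the traces on a subformula closed `Sig` matter for being a Hintikka family. -/
theorem IsHintikka.of_surjective {Sig : Set (Formula S Atom)} (hSig : SubformulaClosed Sig)
    {W W' : Type*} {V : W → Set (Formula S Atom)} {V' : W' → Set (Formula S Atom)}
    (hV : IsHintikka Sig V) {f : W → W'} (hf : Function.Surjective f)
    (hVV' : ∀ w, ∀ φ ∈ Sig, φ ∈ V' (f w) ↔ φ ∈ V w) : IsHintikka Sig V' := by
  have hard : ∀ I w w', HardRel Sig I (V' (f w)) (V' (f w')) ↔ HardRel Sig I (V w) (V w') := by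
    intro I w w'
    refine forall₄_congr fun J _ φ hφ => ?_
    rw [hVV' _ _ hφ, hVV' _ _ hφ]
  have soft : ∀ I w w', SoftRel Sig I (V' (f w)) (V' (f w')) ↔ SoftRel Sig I (V w) (V w') := by
    intro I w w'
    refine and_congr (forall₄_congr fun J _ φ hφ => ?_) (hard I w w')
    rw [hVV' _ _ hφ, hVV' _ _ hφ]
  constructor <;> refine hf.forall.2 fun w => ?_
  · intro φ h
    rw [hVV' _ _ h, hVV' _ _ (hSig.neg h), hV.neg w φ h]
  · intro φ ψ h
    rw [hVV' _ _ h, hVV' _ _ (hSig.and_left h), hVV' _ _ (hSig.and_right h), hV.and w φ ψ h]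
  · intro I φ h
    rw [hVV' _ _ h, hV.box w I φ h, hf.forall]
    exact forall_congr' fun w' => by rw [soft, hVV' _ _ (hSig.box h)]
  · intro I φ h
    rw [hVV' _ _ h, hV.all w I φ h, hf.forall]
    exact forall_congr' fun w' => by rw [hard, hVV' _ _ (hSig.all h)]

namespace IsMaximal

variable {T T' : Set (Formula S Atom)}

/-- If `T'` contains every `ψ` with `[∀]_I ψ ∈ T`, then `T` and `T'` are related by `HardRel`:
axiom 4 carries over the formulas `[∀]_J ψ ∈ T`, and axiom 5 those outside `T`. -/
theorem hardRel_of_forall (hT : IsMaximal T) (hT' : IsMaximal T') {Sig : Set (Formula S Atom)}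
    {I : S} (h : ∀ ψ, Formula.all I ψ ∈ T → ψ ∈ T') : HardRel Sig I T T' := by
  intro J hJ φ _
  refine ⟨fun hφ => h _ ?_, fun hφ => ?_⟩
  · exact hT.mp_provable (.all_mono J I hJ _) (hT.mp_provable (.all_4 J φ) hφ)
  · by_contra hcon
    have := hT.mp_provable (.all_5 J φ) ((hT.neg_mem _).2 hcon)
    exact (hT'.neg_mem _).1 (h _ (hT.mp_provable (.all_mono J I hJ _) this)) hφ

theorem softRel_of_forall (hT : IsMaximal T) (hT' : IsMaximal T') {Sig : Set (Formula S Atom)}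
    {I : S} (h : ∀ ψ, Formula.box I ψ ∈ T → ψ ∈ T') : SoftRel Sig I T T' := by
  refine ⟨fun J hJ φ _ hφ => h _ ?_, hT.hardRel_of_forall hT' fun ψ hψ => h ψ ?_⟩
  · exact hT.mp_provable (.box_mono J I hJ _) (hT.mp_provable (.box_4 J φ) hφ)
  · exact hT.mp_provable (.incl I ψ) hψ

end IsMaximal

/-- The canonical family: the maximal theories form a Hintikka family for every `Sig`. -/
theorem isHintikka_isMaximal (Sig : Set (Formula S Atom)) :
    IsHintikka Sig (fun T : {T : Set (Formula S Atom) // IsMaximal T} => T.1) where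
  neg T φ _ := T.2.neg_mem φ
  and T φ ψ _ := T.2.and_mem φ ψ
  box T I φ hφ := by
    refine ⟨fun h T' hTT' => ?_, fun h => ?_⟩
    · exact T'.2.mp_provable (.box_T I φ) (hTT'.1 I subset_rfl φ hφ h)
    · by_contra hcon
      obtain ⟨T', hTT', hT', hφT'⟩ := (T.2.setOf_box_mem I).exists_isMaximal hcon
      exact hφT' (h ⟨T', hT'⟩ (T.2.softRel_of_forall hT' fun ψ hψ => hTT' hψ))
  all T I φ hφ := by
    refine ⟨fun h T' hTT' => ?_, fun h => ?_⟩
    · exact T'.2.mp_provable (.all_T I φ) ((hTT' I subset_rfl φ hφ).1 h)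
    · by_contra hcon
      obtain ⟨T', hTT', hT', hφT'⟩ := (T.2.setOf_all_mem I).exists_isMaximal hcon
      exact hφT' (h ⟨T', hT'⟩ (T.2.hardRel_of_forall hT' fun ψ hψ => hTT' hψ))

/-! ### Unravelling -/

/-- Histories: finite sequences of states, consecutive ones linked by a label. They form a forest,
in which `node h I w` is a child of `h`. -/
inductive History (L : Type) (W : Type u) : Type u
  | root (w : W) : History L W
  | node (h : History L W) (I : L) (w : W) : History L W

namespace History

variable {W : Type u}

/-- The state in which a history ends. -/
def last : History S W → W
  | root w => w
  | node _ _ w => w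

/-- The number of steps of a history. -/
def length : History S W → ℕ
  | root _ => 0
  | node h _ _ => h.length + 1

variable (Sig : Set (Formula S Atom)) (V : W → Set (Formula S Atom))

/-- `h'` is a child of `h` by a step whose label is a group with member `i` and respects
`SoftRel`. -/
def SoftStep (i : Fin n) (h h' : History S W) : Prop :=
  ∃ (I : S) (w : W), h' = node h I w ∧ i ∈ I.1.1 ∧ SoftRel Sig I (V h.last) (V w)

open Classical in
/-- The topmost ancestor of a history that is reached through steps whose labels are groups with
member `i` and respect `HardRel`. Two histories lie in the same cell of agent `i` when they have
the same `top i`. -/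
noncomputable def top (i : Fin n) : History S W → History S W
  | root w => root w
  | node h I w =>
    if i ∈ I.1.1 ∧ HardRel Sig I (V h.last) (V w) then top i h else node h I w

variable {Sig V}

theorem SoftStep.top_eq {i : Fin n} {h h' : History S W} (hs : SoftStep Sig V i h h') :
    top Sig V i h' = top Sig V i h := by
  obtain ⟨I, w, rfl, hi, hr⟩ := hs
  exact if_pos ⟨hi, hr.2⟩

theorem length_top_le (i : Fin n) (h : History S W) : (top Sig V i h).length ≤ h.length := by
  induction h with
  | root w => exact le_rfl
  | node h I w ih =>
    rw [top]
    split_ifs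
    · exact ih.trans (Nat.le_succ _)
    · exact le_rfl

theorem eq_of_top_eq {i : Fin n} {h : History S W} (he : (top Sig V i h).length = h.length) :
    top Sig V i h = h := by
  cases h with
  | root w => rfl
  | node h I w =>
    rw [top] at he ⊢
    split_ifs at he ⊢
    · have := length_top_le (Sig := Sig) (V := V) i h
      simp only [length] at he
      omega
    · rfl

/-- Either every member of a group `I` can go up from `h` by the last step of `h`, which is then
labelled by a group that includes `I`, or some member of `I` is already at the top. -/
theorem exists_parent_or_top_eq (I : S) (h : History S W) :
    (∃ h₀ : History S W, (∀ i ∈ I.1.1, top Sig V i h = top Sig V i h₀) ∧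
      HardRel Sig I (V h₀.last) (V h.last) ∧ h₀.length < h.length) ∨
    ∃ i ∈ I.1.1, top Sig V i h = h := by
  cases h with
  | root w => exact .inr ⟨_, I.1.2.choose_spec, rfl⟩
  | node h₀ L w =>
    by_cases hc : ∀ i ∈ I.1.1, i ∈ L.1.1 ∧ HardRel Sig L (V h₀.last) (V w)
    · refine .inl ⟨h₀, fun i hi => if_pos (hc i hi), ?_, Nat.lt_succ_self _⟩
      exact (hc _ I.1.2.choose_spec).2.anti fun i hi => (hc i hi).1
    · push Not at hc
      obtain ⟨i, hi, hc⟩ := hc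
      exact .inr ⟨i, hi, if_neg fun h => hc h.1 h.2⟩

/-- Histories that share the cells of all members of `I` end in `HardRel Sig I` related states. In
the forest, the path between the two is unique, so that each of its labels includes `I`. -/
theorem hardRel_of_top_eq (I : S) (h h' : History S W)
    (ht : ∀ i ∈ I.1.1, top Sig V i h = top Sig V i h') :
    HardRel Sig I (V h.last) (V h'.last) := by
  obtain ⟨h₀, h₁, h₂, hlt⟩ | ⟨i, hi, hti⟩ := exists_parent_or_top_eq (Sig := Sig) (V := V) I h
  · exact h₂.symm.trans (hardRel_of_top_eq I h₀ h' fun i hi => (h₁ i hi).symm.trans (ht i hi))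
  obtain ⟨h₀, h₁, h₂, hlt⟩ | ⟨j, hj, htj⟩ := exists_parent_or_top_eq (Sig := Sig) (V := V) I h'
  · exact (hardRel_of_top_eq I h h₀ fun i hi => (ht i hi).trans (h₁ i hi)).trans h₂
  -- Each of `h` and `h'` is an ancestor of the other, so they are equal.
  have e₁ : h = top Sig V i h' := hti.symm.trans (ht i hi)
  have e₂ : top Sig V j h = h' := (ht j hj).trans htj
  have l₁ : h.length ≤ h'.length := by
    conv_lhs => rw [e₁]
    exact length_top_le i h'
  have l₂ : h'.length ≤ h.length := by
    conv_lhs => rw [← e₂]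
    exact length_top_le j h
  have : h = h' := e₁.trans (eq_of_top_eq (by rw [← e₁]; omega))
  exact this ▸ .refl
termination_by h.length + h'.length

/-- The analogue of `hardRel_of_top_eq` for the preorders generated by the soft steps. -/
theorem softRel_of_reflTransGen (I : S) (h h' : History S W)
    (hs : ∀ i ∈ I.1.1, Relation.ReflTransGen (SoftStep Sig V i) h h') :
    SoftRel Sig I (V h.last) (V h'.last) := by
  induction h' with
  | root w =>
    obtain h₁ | ⟨_, _, _, _, h₁, _⟩ := (hs _ I.1.2.choose_spec).cases_tail
    · exact h₁ ▸ .refl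
    · cases h₁
  | node h₀ L w ih =>
    by_cases he : node h₀ L w = h
    · exact he ▸ .refl
    have key : ∀ i ∈ I.1.1, Relation.ReflTransGen (SoftStep Sig V i) h h₀ ∧ i ∈ L.1.1 ∧
        SoftRel Sig L (V h₀.last) (V w) := by
      intro i hi
      obtain h₁ | ⟨_, h₂, _, _, h₁, h₃⟩ := (hs i hi).cases_tail
      · exact absurd h₁ he
      · cases h₁
        exact ⟨h₂, h₃⟩
    exact (ih fun i hi => (key i hi).1).trans
      ((key _ I.1.2.choose_spec).2.2.anti fun i hi => (key i hi).2.1)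

end History

open History

/-- The unravelling of a family `V`: the cells of agent `i` are the fibres of `top i`, and its open
sets are the sets that are closed under the soft steps of `i`. -/
noncomputable def unravelling (Sig : Set (Formula S Atom)) {W : Type u}
    (V : W → Set (Formula S Atom)) : TopoEModel.{u, v} n Atom where
  X := History S W
  cells i := (Setoid.ker (top Sig V i)).classes
  isPartition i := Setoid.isPartition_classes _
  top i :=
    { IsOpen U := ∀ h ∈ U, ∀ h', SoftStep Sig V i h h' → h' ∈ U
      isOpen_univ := fun _ _ _ _ => trivial
      isOpen_inter := fun _ _ hA hB h hh h' hs => ⟨hA h hh.1 h' hs, hB h hh.2 h' hs⟩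
      isOpen_sUnion := fun _ hc h ⟨A, hA, hh⟩ h' hs => ⟨A, hA, hc A hA h hh h' hs⟩ }
  cells_open := by
    rintro i _ ⟨h₀, rfl⟩ h hh h' hs
    exact hs.top_eq.trans hh
  val p := {h | Formula.atom p ∈ V h.last}

section Truth

variable {Sig : Set (Formula S Atom)} {W : Type u} {V : W → Set (Formula S Atom)}

theorem isOpen_unravelling_iff {i : Fin n} {U : Set (History S W)} :
    IsOpen[(unravelling Sig V).top i] U ↔ ∀ h ∈ U, ∀ h', SoftStep Sig V i h h' → h' ∈ U :=
  Iff.rfl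

theorem mem_cell_unravelling {i : Fin n} {h h' : History S W} :
    h' ∈ (unravelling Sig V).cell i h ↔ top Sig V i h = top Sig V i h' := by
  constructor
  · rintro ⟨_, ⟨h₀, rfl⟩, h₁, h₂⟩
    exact Eq.trans h₁ (Eq.symm h₂)
  · exact fun he => ⟨_, ⟨h, rfl⟩, rfl, he.symm⟩

/-- A child of `h` by a soft step labelled `I` lies in every `τ_I`-open set around `h`. -/
theorem node_mem_of_isOpen_groupTop {I : S} {U : Set (History S W)}
    (hU : IsOpen[(unravelling Sig V).groupTop I.1] U) {h : History S W} (hh : h ∈ U) {w : W}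
    (hw : SoftRel Sig I (V h.last) (V w)) : node h I w ∈ U := by
  induction hU with
  | basic U hU =>
    obtain ⟨i, hi, hU⟩ := Set.mem_iUnion₂.1 hU
    exact hU h hh _ ⟨I, w, rfl, hi, hw⟩
  | univ => trivial
  | inter A B _ _ ihA ihB => exact ⟨ihA hh.1, ihB hh.2⟩
  | sUnion c _ ih =>
    obtain ⟨A, hA, hh⟩ := hh
    exact ⟨A, hA, ih A hA hh⟩

/-- The truth lemma: in the unravelling of a Hintikka family, the formulas of `Sig` that are true
at a history are those in the set of its last state. -/
theorem mem_interp_unravelling (hSig : SubformulaClosed Sig) (hV : IsHintikka Sig V)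
    {φ : Formula S Atom} (hφ : φ ∈ Sig) (h : History S W) :
    h ∈ (unravelling Sig V).interp φ ↔ φ ∈ V h.last := by
  induction φ generalizing h with
  | atom p => exact Iff.rfl
  | neg φ ih => exact (not_congr (ih (hSig.neg hφ) h)).trans (hV.neg _ φ hφ).symm
  | and φ ψ ih₁ ih₂ =>
    exact (and_congr (ih₁ (hSig.and_left hφ) h) (ih₂ (hSig.and_right hφ) h)).trans
      (hV.and _ φ ψ hφ).symm
  | box I φ ih =>
    replace ih := ih (hSig.box hφ)
    rw [hV.box _ I φ hφ]
    constructor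
    · rintro ⟨U, hU, hh, hUP⟩ w hw
      exact (ih (node h I w)).1 (hUP (node_mem_of_isOpen_groupTop hU hh hw))
    · intro hbox
      -- the least `τ_I`-open set around `h`
      refine ⟨⋂ i ∈ I.1.1, {h' | Relation.ReflTransGen (SoftStep Sig V i) h h'}, ?_, ?_, ?_⟩
      · refine @isOpen_biInter_finset _ _ ((unravelling Sig V).groupTop I.1) _ _ fun i hi => ?_
        exact TopoEModel.isOpen_groupTop_of_isOpen _ hi
          (isOpen_unravelling_iff.2 fun h₁ hh₁ h₂ hs => Relation.ReflTransGen.tail hh₁ hs)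
      · exact Set.mem_iInter₂.2 fun i _ => .refl
      · intro h' hh'
        exact (ih h').2 (hbox _ (softRel_of_reflTransGen I h h' (Set.mem_iInter₂.1 hh')))
  | all I φ ih =>
    replace ih := ih (hSig.all hφ)
    rw [hV.all _ I φ hφ]
    constructor
    · intro hall w hw
      refine (ih (node h I w)).1 (hall (Set.mem_iInter₂.2 fun i hi => ?_))
      exact mem_cell_unravelling.2 (Eq.symm (if_pos ⟨hi, hw⟩))
    · intro hall h' hh'
      refine (ih h').2 (hall _ (hardRel_of_top_eq I h h' fun i hi => ?_))
      exact mem_cell_unravelling.1 (Set.mem_iInter₂.1 hh' i hi)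

end Truth

/-! ### Primitive recursive predicates -/

section Primrec

variable {α : Type*} [Primcodable α] {p q : α → Prop} {f g : α → ℕ} {P : α → ℕ → Prop}

theorem primrecPred_const (c : Prop) : PrimrecPred fun _ : α => c := by
  classical exact ⟨fun _ => inferInstance, Primrec.const (decide c)⟩

theorem primrecPred_imp (hp : PrimrecPred p) (hq : PrimrecPred q) :
    PrimrecPred fun a => p a → q a :=
  (hp.not.or hq).of_eq fun _ => imp_iff_not_or.symm

theorem primrecPred_iff (hp : PrimrecPred p) (hq : PrimrecPred q) :
    PrimrecPred fun a => p a ↔ q a :=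
  ((primrecPred_imp hp hq).and (primrecPred_imp hq hp)).of_eq fun _ => iff_def.symm

theorem primrecPred_forall_lt (hf : Primrec f) (hP : PrimrecPred fun x : α × ℕ => P x.1 x.2) :
    PrimrecPred fun a => ∀ x < f a, P a x :=
  ((PrimrecRel.forall_mem_list (R := fun (x : ℕ) (a : α) => P a x)
    (hP.comp (Primrec.pair Primrec.snd Primrec.fst))).comp
      (Primrec.list_range.comp hf) .id).of_eq fun a => by simp

theorem primrecPred_exists_lt (hf : Primrec f) (hP : PrimrecPred fun x : α × ℕ => P x.1 x.2) :
    PrimrecPred fun a => ∃ x < f a, P a x :=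
  ((PrimrecRel.exists_mem_list (R := fun (x : ℕ) (a : α) => P a x)
    (hP.comp (Primrec.pair Primrec.snd Primrec.fst))).comp
      (Primrec.list_range.comp hf) .id).of_eq fun a => by simp

theorem primrecPred_forall_finite {ι : Type*} [Finite ι] {Q : ι → α → Prop}
    (hQ : ∀ i, PrimrecPred (Q i)) : PrimrecPred fun a => ∀ i, Q i a := by
  have key : ∀ F : Set ι, F.Finite → PrimrecPred fun a => ∀ i ∈ F, Q i a := by
    intro F hF
    induction F, hF using Set.Finite.induction_on with
    | empty => exact (primrecPred_const True).of_eq fun a => by simp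
    | @insert i _ _ _ ih => exact ((hQ i).and ih).of_eq fun a => by simp
  exact (key Set.univ Set.finite_univ).of_eq fun a => by simp

theorem primrecPred_exists_finite {ι : Type*} [Finite ι] {Q : ι → α → Prop}
    (hQ : ∀ i, PrimrecPred (Q i)) : PrimrecPred fun a => ∃ i, Q i a :=
  (primrecPred_forall_finite fun i => (hQ i).not).not.of_eq fun a => by simp

theorem primrec_two_pow (hf : Primrec f) : Primrec fun a => 2 ^ f a :=
  (Primrec₂.unpaired'.1 Nat.Primrec.pow).comp (Primrec.const 2) hf

theorem primrecPred_testBit (hf : Primrec f) (hg : Primrec g) :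
    PrimrecPred fun a => (f a).testBit (g a) :=
  (Primrec.eq.comp (Primrec.nat_mod.comp (Primrec.nat_div.comp hf (primrec_two_pow hg))
    (Primrec.const 2)) (Primrec.const 1)).of_eq fun a => by simp [Nat.testBit_eq_decide_div_mod_eq]

end Primrec

/-- Every set of numbers below `N` is the set of the positions of the digits `1` of a number. -/
theorem exists_testBit_iff (N : ℕ) (p : ℕ → Prop) :
    ∃ m < 2 ^ N, ∀ c < N, m.testBit c ↔ p c := by
  classical
  have key : ∀ c, (∑ i ∈ Finset.range N with p i, 2 ^ i).testBit c ↔ c < N ∧ p c := by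
    intro c
    rw [← Nat.mem_bitIndices, ← List.mem_toFinset, Finset.toFinset_bitIndices_sum_two_pow]
    simp
  refine ⟨∑ i ∈ Finset.range N with p i, 2 ^ i, Nat.lt_pow_two_of_testBit _ fun c hc => ?_,
    fun c hc => ?_⟩
  · exact Bool.eq_false_iff.2 fun h => absurd ((key c).1 h).1 (not_lt.2 hc)
  · exact (key c).trans (and_iff_right hc)

theorem lt_of_testBit {m N c : ℕ} (hm : m < 2 ^ N) (hc : m.testBit c) : c < N := by
  by_contra h
  rw [Nat.testBit_lt_two_pow (hm.trans_le (Nat.pow_le_pow_right two_pos (not_lt.1 h)))] at hc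
  cases hc

/-! ### Gödel numbers -/

section Code

theorem lt_pair_of_pos {a b : ℕ} (ha : 0 < a) : b < Nat.pair a b :=
  (Nat.lt_add_of_pos_left ha).trans_le (Nat.add_le_pair a b)

variable [Primcodable Atom] {φ : Formula S Atom} {d e : ℕ} {I : S}

theorem Formula.code_eq_neg_iff :
    φ.code = Nat.pair 1 d ↔ ∃ ψ : Formula S Atom, φ = .neg ψ ∧ ψ.code = d := by
  cases φ <;> simp [Formula.code]

theorem Formula.code_eq_and_iff :
    φ.code = Nat.pair 2 (Nat.pair d e) ↔
      ∃ ψ χ : Formula S Atom, φ = .and ψ χ ∧ ψ.code = d ∧ χ.code = e := by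
  cases φ <;> simp [Formula.code, and_assoc]

theorem Formula.code_eq_box_iff :
    φ.code = Nat.pair 3 (Nat.pair (groupCode I.1) d) ↔
      ∃ ψ : Formula S Atom, φ = .box I ψ ∧ ψ.code = d := by
  cases φ <;> simp [Formula.code, groupCode_injective.eq_iff, Subtype.ext_iff]

theorem Formula.code_eq_all_iff :
    φ.code = Nat.pair 4 (Nat.pair (groupCode I.1) d) ↔
      ∃ ψ : Formula S Atom, φ = .all I ψ ∧ ψ.code = d := by
  cases φ <;> simp [Formula.code, groupCode_injective.eq_iff, Subtype.ext_iff]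

theorem subformulaClosed_code_lt (N : ℕ) :
    SubformulaClosed {φ : Formula S Atom | φ.code < N} where
  neg h := (lt_pair_of_pos one_pos).trans h
  and_left h := ((Nat.left_le_pair _ _).trans_lt (lt_pair_of_pos two_pos)).trans h
  and_right h := ((Nat.right_le_pair _ _).trans_lt (lt_pair_of_pos two_pos)).trans h
  box h := ((Nat.right_le_pair _ _).trans_lt (lt_pair_of_pos three_pos)).trans h
  all h := ((Nat.right_le_pair _ _).trans_lt (lt_pair_of_pos four_pos)).trans h

variable (S Atom)

/-- The recursive clauses for `c` to be a Gödel number of a formula, where `p` is the predicate of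
being a Gödel number on smaller numbers. The bound `N` on the components of `c` is there to make the
quantifiers bounded. -/
def CodeClause (N : ℕ) (p : ℕ → Prop) (c : ℕ) : Prop :=
  (∃ a < N, c = Nat.pair 0 a ∧ a ∈ Set.range (Encodable.encode : Atom → ℕ)) ∨
  (∃ d < N, c = Nat.pair 1 d ∧ p d) ∨
  (∃ d < N, ∃ e < N, c = Nat.pair 2 (Nat.pair d e) ∧ p d ∧ p e) ∨
  (∃ I : S, ∃ d < N, c = Nat.pair 3 (Nat.pair (groupCode I.1) d) ∧ p d) ∨
  (∃ I : S, ∃ d < N, c = Nat.pair 4 (Nat.pair (groupCode I.1) d) ∧ p d)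

theorem codeClause_congr {N : ℕ} {p q : ℕ → Prop} {c : ℕ} (h : ∀ d < c, p d ↔ q d) :
    CodeClause S Atom N p c ↔ CodeClause S Atom N q c := by
  refine or_congr Iff.rfl (or_congr ?_ (or_congr ?_ (or_congr ?_ ?_)))
  · refine exists_congr fun d => and_congr_right fun _ => and_congr_right fun hc => h d ?_
    exact hc ▸ lt_pair_of_pos one_pos
  · refine exists_congr fun d => and_congr_right fun _ => exists_congr fun e =>
      and_congr_right fun _ => and_congr_right fun hc => and_congr (h d ?_) (h e ?_)
    · exact hc ▸ (Nat.left_le_pair _ _).trans_lt (lt_pair_of_pos two_pos)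
    · exact hc ▸ (Nat.right_le_pair _ _).trans_lt (lt_pair_of_pos two_pos)
  · refine exists_congr fun I => exists_congr fun d => and_congr_right fun _ =>
      and_congr_right fun hc => h d ?_
    exact hc ▸ (Nat.right_le_pair _ _).trans_lt (lt_pair_of_pos three_pos)
  · refine exists_congr fun I => exists_congr fun d => and_congr_right fun _ =>
      and_congr_right fun hc => h d ?_
    exact hc ▸ (Nat.right_le_pair _ _).trans_lt (lt_pair_of_pos four_pos)

theorem exists_code_eq_iff {c N : ℕ} (hc : c < N) :
    (∃ φ : Formula S Atom, φ.code = c) ↔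
      CodeClause S Atom N (fun d => ∃ φ : Formula S Atom, φ.code = d) c := by
  have hSig := subformulaClosed_code_lt (S := S) (Atom := Atom) N
  constructor
  · rintro ⟨φ, rfl⟩
    cases φ with
    | atom p => exact .inl ⟨_, (Nat.right_le_pair _ _).trans_lt hc, rfl, p, rfl⟩
    | neg φ => exact .inr (.inl ⟨_, hSig.neg hc, rfl, φ, rfl⟩)
    | and φ ψ =>
      exact .inr (.inr (.inl
        ⟨_, hSig.and_left hc, _, hSig.and_right hc, rfl, ⟨φ, rfl⟩, ψ, rfl⟩))
    | box I φ => exact .inr (.inr (.inr (.inl ⟨I, _, hSig.box hc, rfl, φ, rfl⟩)))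
    | all I φ => exact .inr (.inr (.inr (.inr ⟨I, _, hSig.all hc, rfl, φ, rfl⟩)))
  · rintro (⟨_, _, rfl, p, rfl⟩ | ⟨_, _, rfl, φ, rfl⟩ | ⟨_, _, _, _, rfl, ⟨φ, rfl⟩, ψ, rfl⟩ |
      ⟨I, _, _, rfl, φ, rfl⟩ | ⟨I, _, _, rfl, φ, rfl⟩)
    exacts [⟨.atom p, rfl⟩, ⟨.neg φ, rfl⟩, ⟨.and φ ψ, rfl⟩, ⟨.box I φ, rfl⟩, ⟨.all I φ, rfl⟩]

/-- The digits of `s` mark the Gödel numbers of formulas among the numbers below `N`. This is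
phrased by the recursive clauses for Gödel numbers, so that it is primitive recursive; see
`IsCodeMask.testBit_iff`. -/
def IsCodeMask (N s : ℕ) : Prop :=
  s < 2 ^ N ∧ ∀ c < N, s.testBit c ↔ CodeClause S Atom N (fun d => s.testBit d) c

theorem exists_isCodeMask (N : ℕ) : ∃ s, IsCodeMask S Atom N s := by
  obtain ⟨s, hs, hsc⟩ := exists_testBit_iff N fun c => ∃ φ : Formula S Atom, φ.code = c
  refine ⟨s, hs, fun c hc => ?_⟩
  rw [hsc c hc, exists_code_eq_iff S Atom hc]
  exact codeClause_congr S Atom fun d hd => (hsc d (hd.trans hc)).symm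

variable {S Atom}

theorem IsCodeMask.testBit_iff {N s : ℕ} (hs : IsCodeMask S Atom N s) {c : ℕ} :
    s.testBit c ↔ c < N ∧ ∃ φ : Formula S Atom, φ.code = c := by
  suffices h : ∀ c, c < N → (s.testBit c ↔ ∃ φ : Formula S Atom, φ.code = c) from
    ⟨fun hc => ⟨lt_of_testBit hs.1 hc, (h c (lt_of_testBit hs.1 hc)).1 hc⟩,
      fun hc => (h c hc.1).2 hc.2⟩
  intro c
  induction c using Nat.strong_induction_on with
  | _ c ih =>
  intro hc
  rw [hs.2 c hc, exists_code_eq_iff S Atom hc]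
  exact codeClause_congr S Atom fun d hd => ih d hd (hd.trans hc)

/-! ### Hintikka families as numbers -/

variable (S)

/-- `HardRel` for the sets of formulas whose Gödel numbers are marked by the digits of `t` and `t'`,
relative to the formulas with Gödel numbers marked by `s`. -/
def HardRelCode (N s : ℕ) (I : S) (t t' : ℕ) : Prop :=
  ∀ J : S, J.1.1 ⊆ I.1.1 → ∀ d < N, s.testBit (Nat.pair 4 (Nat.pair (groupCode J.1) d)) →
    (t.testBit (Nat.pair 4 (Nat.pair (groupCode J.1) d)) ↔
      t'.testBit (Nat.pair 4 (Nat.pair (groupCode J.1) d)))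

/-- `SoftRel` for sets of formulas given by numbers, as in `HardRelCode`. -/
def SoftRelCode (N s : ℕ) (I : S) (t t' : ℕ) : Prop :=
  (∀ J : S, J.1.1 ⊆ I.1.1 → ∀ d < N, s.testBit (Nat.pair 3 (Nat.pair (groupCode J.1) d)) →
    t.testBit (Nat.pair 3 (Nat.pair (groupCode J.1) d)) →
      t'.testBit (Nat.pair 3 (Nat.pair (groupCode J.1) d))) ∧ HardRelCode S N s I t t'

/-- The truth conditions of a Hintikka family at the set of formulas given by `t`, where the digits
of `m` mark the members of the family. -/
def HintikkaAt (N s m t : ℕ) : Prop :=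
  (∀ d < N, s.testBit (Nat.pair 1 d) → (t.testBit (Nat.pair 1 d) ↔ ¬ t.testBit d)) ∧
  (∀ d < N, ∀ e < N, s.testBit (Nat.pair 2 (Nat.pair d e)) →
    (t.testBit (Nat.pair 2 (Nat.pair d e)) ↔ t.testBit d ∧ t.testBit e)) ∧
  (∀ I : S, ∀ d < N, s.testBit (Nat.pair 3 (Nat.pair (groupCode I.1) d)) →
    (t.testBit (Nat.pair 3 (Nat.pair (groupCode I.1) d)) ↔
      ∀ t' < 2 ^ N, m.testBit t' → SoftRelCode S N s I t t' → t'.testBit d)) ∧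
  (∀ I : S, ∀ d < N, s.testBit (Nat.pair 4 (Nat.pair (groupCode I.1) d)) →
    (t.testBit (Nat.pair 4 (Nat.pair (groupCode I.1) d)) ↔
      ∀ t' < 2 ^ N, m.testBit t' → HardRelCode S N s I t t' → t'.testBit d))

/-- Some Hintikka family for the formulas with Gödel numbers below `N`, given by a number `m` whose
digits mark numbers that in turn mark Gödel numbers, has a member without the formula with
Gödel number `k`. -/
def Refutable (N s k : ℕ) : Prop :=
  ∃ m < 2 ^ 2 ^ N, (∀ t < 2 ^ N, m.testBit t → HintikkaAt S N s m t) ∧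
    ∃ t < 2 ^ N, m.testBit t ∧ ¬ t.testBit k

variable {S}

/-- The set of formulas whose Gödel numbers are the positions of the digits `1` of `t`. -/
def formulasOf (S : Set (AgentGroup n)) (Atom : Type v) [Primcodable Atom] (t : ℕ) :
    Set (Formula S Atom) :=
  {φ | t.testBit φ.code}

section Decode

variable {N s : ℕ} (hs : IsCodeMask S Atom N s)
include hs

theorem IsCodeMask.forall_neg_iff {Q : ℕ → Prop} :
    (∀ d < N, s.testBit (Nat.pair 1 d) → Q d) ↔
      ∀ φ : Formula S Atom, φ.neg.code < N → Q φ.code := by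
  have hSig := subformulaClosed_code_lt (S := S) (Atom := Atom) N
  refine ⟨fun h φ hφ => h _ (hSig.neg hφ) (hs.testBit_iff.2 ⟨hφ, .neg φ, rfl⟩),
    fun h d _ hd => ?_⟩
  obtain ⟨hlt, φ, hφ⟩ := hs.testBit_iff.1 hd
  obtain ⟨ψ, rfl, rfl⟩ := Formula.code_eq_neg_iff.1 hφ
  exact h ψ hlt

theorem IsCodeMask.forall_and_iff {Q : ℕ → ℕ → Prop} :
    (∀ d < N, ∀ e < N, s.testBit (Nat.pair 2 (Nat.pair d e)) → Q d e) ↔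
      ∀ φ ψ : Formula S Atom, (φ.and ψ).code < N → Q φ.code ψ.code := by
  have hSig := subformulaClosed_code_lt (S := S) (Atom := Atom) N
  refine ⟨fun h φ ψ hφ => h _ (hSig.and_left hφ) _ (hSig.and_right hφ)
    (hs.testBit_iff.2 ⟨hφ, .and φ ψ, rfl⟩), fun h d _ e _ hd => ?_⟩
  obtain ⟨hlt, φ, hφ⟩ := hs.testBit_iff.1 hd
  obtain ⟨ψ, χ, rfl, rfl, rfl⟩ := Formula.code_eq_and_iff.1 hφ
  exact h ψ χ hlt

theorem IsCodeMask.forall_box_iff {I : S} {Q : ℕ → Prop} :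
    (∀ d < N, s.testBit (Nat.pair 3 (Nat.pair (groupCode I.1) d)) → Q d) ↔
      ∀ φ : Formula S Atom, (Formula.box I φ).code < N → Q φ.code := by
  have hSig := subformulaClosed_code_lt (S := S) (Atom := Atom) N
  refine ⟨fun h φ hφ => h _ (hSig.box hφ) (hs.testBit_iff.2 ⟨hφ, .box I φ, rfl⟩),
    fun h d _ hd => ?_⟩
  obtain ⟨hlt, φ, hφ⟩ := hs.testBit_iff.1 hd
  obtain ⟨ψ, rfl, rfl⟩ := Formula.code_eq_box_iff.1 hφ
  exact h ψ hlt

theorem IsCodeMask.forall_all_iff {I : S} {Q : ℕ → Prop} :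
    (∀ d < N, s.testBit (Nat.pair 4 (Nat.pair (groupCode I.1) d)) → Q d) ↔
      ∀ φ : Formula S Atom, (Formula.all I φ).code < N → Q φ.code := by
  have hSig := subformulaClosed_code_lt (S := S) (Atom := Atom) N
  refine ⟨fun h φ hφ => h _ (hSig.all hφ) (hs.testBit_iff.2 ⟨hφ, .all I φ, rfl⟩),
    fun h d _ hd => ?_⟩
  obtain ⟨hlt, φ, hφ⟩ := hs.testBit_iff.1 hd
  obtain ⟨ψ, rfl, rfl⟩ := Formula.code_eq_all_iff.1 hφ
  exact h ψ hlt

theorem IsCodeMask.hardRelCode_iff {I : S} {t t' : ℕ} :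
    HardRelCode S N s I t t' ↔
      HardRel {φ | φ.code < N} I (formulasOf S Atom t) (formulasOf S Atom t') :=
  forall₂_congr fun _ _ => hs.forall_all_iff

theorem IsCodeMask.softRelCode_iff {I : S} {t t' : ℕ} :
    SoftRelCode S N s I t t' ↔
      SoftRel {φ | φ.code < N} I (formulasOf S Atom t) (formulasOf S Atom t') :=
  and_congr (forall₂_congr fun _ _ => hs.forall_box_iff) hs.hardRelCode_iff

theorem IsCodeMask.isHintikka_iff {m : ℕ} :
    (∀ t < 2 ^ N, m.testBit t → HintikkaAt S N s m t) ↔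
      IsHintikka {φ | φ.code < N}
        fun t : ULift.{u} {t // t < 2 ^ N ∧ m.testBit t} => formulasOf S Atom t.down := by
  simp only [HintikkaAt, hs.forall_neg_iff, hs.forall_and_iff, hs.forall_box_iff,
    hs.forall_all_iff, hs.softRelCode_iff, hs.hardRelCode_iff]
  constructor
  · intro h
    refine ⟨fun t => (h _ t.down.2.1 t.down.2.2).1, fun t => (h _ t.down.2.1 t.down.2.2).2.1,
      fun t I φ hφ => ?_, fun t I φ hφ => ?_⟩
    · exact ((h _ t.down.2.1 t.down.2.2).2.2.1 I φ hφ).trans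
        ⟨fun h t' => h _ t'.down.2.1 t'.down.2.2, fun h t' h₁ h₂ => h ⟨t', h₁, h₂⟩⟩
    · exact ((h _ t.down.2.1 t.down.2.2).2.2.2 I φ hφ).trans
        ⟨fun h t' => h _ t'.down.2.1 t'.down.2.2, fun h t' h₁ h₂ => h ⟨t', h₁, h₂⟩⟩
  · intro h t h₁ h₂
    refine ⟨h.neg ⟨t, h₁, h₂⟩, h.and ⟨t, h₁, h₂⟩, fun I φ hφ => ?_, fun I φ hφ => ?_⟩
    · exact (h.box ⟨t, h₁, h₂⟩ I φ hφ).trans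
        ⟨fun h t' h₁ h₂ => h ⟨t', h₁, h₂⟩, fun h t' => h _ t'.down.2.1 t'.down.2.2⟩
    · exact (h.all ⟨t, h₁, h₂⟩ I φ hφ).trans
        ⟨fun h t' h₁ h₂ => h ⟨t', h₁, h₂⟩, fun h t' => h _ t'.down.2.1 t'.down.2.2⟩

theorem IsCodeMask.not_valid {φ : Formula S Atom} (hφ : φ.code < N)
    (h : Refutable S N s φ.code) : ¬ Valid.{u, v} φ := by
  obtain ⟨m, -, hm, t, ht, hmt, htφ⟩ := h
  intro hval
  have hV := hs.isHintikka_iff.{u}.1 hm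
  exact htφ ((mem_interp_unravelling (subformulaClosed_code_lt N) hV hφ
    (.root ⟨t, ht, hmt⟩)).1 (hval (unravelling _ _) _))

/-- Completeness with the finite model property: the traces of the maximal theories on the formulas
with Gödel numbers below `N` make up a Hintikka family given by a number. -/
theorem IsCodeMask.refutable {φ : Formula S Atom} (hφ : φ.code < N)
    (h : ¬ Provable φ) : Refutable S N s φ.code := by
  -- the number that gives the trace of a set of formulas
  have trace : ∀ T : Set (Formula S Atom), ∃ t < 2 ^ N, ∀ φ : Formula S Atom, φ.code < N →
      (t.testBit φ.code ↔ φ ∈ T) := by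
    intro T
    obtain ⟨t, ht, htc⟩ := exists_testBit_iff N fun c => ∃ φ ∈ T, φ.code = c
    refine ⟨t, ht, fun φ hφ => (htc _ hφ).trans ⟨?_, fun h => ⟨φ, h, rfl⟩⟩⟩
    rintro ⟨ψ, hψ, he⟩
    rwa [← Formula.code_injective he]
  choose f hf hfT using trace
  obtain ⟨m, hm, hmt⟩ := exists_testBit_iff (2 ^ N) fun t => ∃ T, IsMaximal T ∧ f T = t
  refine ⟨m, hm, hs.isHintikka_iff.{0}.2 ?_, ?_⟩
  · refine (isHintikka_isMaximal _).of_surjective (subformulaClosed_code_lt N)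
      (f := fun T => ⟨f T.1, hf _, (hmt _ (hf _)).2 ⟨T.1, T.2, rfl⟩⟩) ?_ fun T => hfT T.1
    rintro ⟨t, ht, hmt'⟩
    obtain ⟨T, hT, rfl⟩ := (hmt t ht).1 hmt'
    exact ⟨⟨T, hT⟩, rfl⟩
  · obtain ⟨T, -, hT, hφT⟩ := isTheory_provable.exists_isMaximal h
    exact ⟨f T, hf T, (hmt _ (hf T)).2 ⟨T, hT, rfl⟩, fun h => hφT ((hfT T φ hφ).1 h)⟩

end Decode

end Code

/-! ### Completeness and decidability -/

theorem provable_iff_valid [Countable Atom] (φ : Formula S Atom) :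
    Provable φ ↔ Valid.{u, v} φ := by
  refine ⟨Provable.valid, fun hval => ?_⟩
  by_contra hφ
  -- Any coding of the atoms will do.
  obtain ⟨_⟩ : Nonempty (Primcodable Atom) := by
    obtain _ | _ := finite_or_infinite Atom
    · obtain ⟨k, ⟨e⟩⟩ := Finite.exists_equiv_fin Atom
      exact ⟨Primcodable.ofEquiv _ e⟩
    · obtain ⟨_⟩ := nonempty_denumerable Atom
      exact ⟨inferInstance⟩
  obtain ⟨s, hs⟩ := exists_isCodeMask S Atom (φ.code + 1)
  exact hs.not_valid (Nat.lt_succ_self _) (hs.refutable (Nat.lt_succ_self _) hφ) hval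

section Decidability

variable {α : Type*} [Primcodable α] {N s t t' m k : α → ℕ}

theorem primrec_pair_pair (a b : ℕ) {d : α → ℕ} (hd : Primrec d) :
    Primrec fun x => Nat.pair a (Nat.pair b (d x)) :=
  Primrec₂.natPair.comp (.const a) (Primrec₂.natPair.comp (.const b) hd)

theorem primrecPred_isCodeMask [Primcodable Atom] (hN : Primrec N) (hs : Primrec s) :
    PrimrecPred fun x => IsCodeMask S Atom (N x) (s x) := by
  refine (Primrec.nat_lt.comp hs (primrec_two_pow hN)).and (primrecPred_forall_lt hN ?_)
  replace hN := hN.comp (Primrec.fst (α := α) (β := ℕ))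
  replace hs := hs.comp (Primrec.fst (α := α) (β := ℕ))
  have hc := Primrec.snd (α := α) (β := ℕ)
  refine primrecPred_iff (primrecPred_testBit hs hc) (.or ?_ (.or ?_ (.or ?_ (.or ?_ ?_))))
  · refine primrecPred_exists_lt hN (.and ?_ ?_)
    · exact Primrec.eq.comp (hc.comp .fst) (Primrec₂.natPair.comp (.const 0) .snd)
    · exact (Primcodable.mem_range_encode (α := Atom)).comp .snd
  · refine primrecPred_exists_lt hN (.and ?_ (primrecPred_testBit (hs.comp .fst) .snd))
    exact Primrec.eq.comp (hc.comp .fst) (Primrec₂.natPair.comp (.const 1) .snd)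
  · refine primrecPred_exists_lt hN (primrecPred_exists_lt (hN.comp .fst) (.and ?_ (.and ?_ ?_)))
    · exact Primrec.eq.comp (hc.comp (Primrec.fst.comp .fst)) (Primrec₂.natPair.comp (.const 2)
        (Primrec₂.natPair.comp (Primrec.snd.comp .fst) .snd))
    · exact primrecPred_testBit (hs.comp (Primrec.fst.comp .fst)) (Primrec.snd.comp .fst)
    · exact primrecPred_testBit (hs.comp (Primrec.fst.comp .fst)) .snd
  all_goals
    refine primrecPred_exists_finite fun I => primrecPred_exists_lt hN
      (.and ?_ (primrecPred_testBit (hs.comp .fst) .snd))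
    exact Primrec.eq.comp (hc.comp .fst) (primrec_pair_pair _ _ .snd)

theorem primrecPred_hardRelCode (I : S) (hN : Primrec N) (hs : Primrec s) (ht : Primrec t)
    (ht' : Primrec t') :
    PrimrecPred fun x => HardRelCode S (N x) (s x) I (t x) (t' x) := by
  refine primrecPred_forall_finite fun J => primrecPred_imp (primrecPred_const _)
    (primrecPred_forall_lt hN ?_)
  have hd := primrec_pair_pair 4 (groupCode J.1) (Primrec.snd (α := α) (β := ℕ))
  exact primrecPred_imp (primrecPred_testBit (hs.comp .fst) hd)
    (primrecPred_iff (primrecPred_testBit (ht.comp .fst) hd)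
      (primrecPred_testBit (ht'.comp .fst) hd))

theorem primrecPred_softRelCode (I : S) (hN : Primrec N) (hs : Primrec s) (ht : Primrec t)
    (ht' : Primrec t') :
    PrimrecPred fun x => SoftRelCode S (N x) (s x) I (t x) (t' x) := by
  refine (primrecPred_forall_finite fun J => primrecPred_imp (primrecPred_const _)
    (primrecPred_forall_lt hN ?_)).and (primrecPred_hardRelCode I hN hs ht ht')
  have hd := primrec_pair_pair 3 (groupCode J.1) (Primrec.snd (α := α) (β := ℕ))
  exact primrecPred_imp (primrecPred_testBit (hs.comp .fst) hd)
    (primrecPred_imp (primrecPred_testBit (ht.comp .fst) hd)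
      (primrecPred_testBit (ht'.comp .fst) hd))

theorem primrecPred_hintikkaAt (hN : Primrec N) (hs : Primrec s) (hm : Primrec m)
    (ht : Primrec t) : PrimrecPred fun x => HintikkaAt S (N x) (s x) (m x) (t x) := by
  have hN₁ := hN.comp (Primrec.fst (α := α) (β := ℕ))
  have hs₁ := hs.comp (Primrec.fst (α := α) (β := ℕ))
  have hm₁ := hm.comp (Primrec.fst (α := α) (β := ℕ))
  have ht₁ := ht.comp (Primrec.fst (α := α) (β := ℕ))
  have hd₁ := Primrec.snd (α := α) (β := ℕ)
  refine .and (primrecPred_forall_lt hN ?_) (.and (primrecPred_forall_lt hN ?_)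
    (.and (primrecPred_forall_finite fun I => primrecPred_forall_lt hN ?_)
      (primrecPred_forall_finite fun I => primrecPred_forall_lt hN ?_)))
  · have hc := Primrec₂.natPair.comp (.const 1) hd₁
    exact primrecPred_imp (primrecPred_testBit hs₁ hc)
      (primrecPred_iff (primrecPred_testBit ht₁ hc) (primrecPred_testBit ht₁ hd₁).not)
  · refine primrecPred_forall_lt hN₁ ?_
    have he := Primrec.snd (α := α × ℕ) (β := ℕ)
    have hc := Primrec₂.natPair.comp (.const 2) (Primrec₂.natPair.comp (hd₁.comp .fst) he)
    exact primrecPred_imp (primrecPred_testBit (hs₁.comp .fst) hc)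
      (primrecPred_iff (primrecPred_testBit (ht₁.comp .fst) hc)
        ((primrecPred_testBit (ht₁.comp .fst) (hd₁.comp .fst)).and
          (primrecPred_testBit (ht₁.comp .fst) he)))
  · have hc := primrec_pair_pair 3 (groupCode I.1) hd₁
    refine primrecPred_imp (primrecPred_testBit hs₁ hc) (primrecPred_iff
      (primrecPred_testBit ht₁ hc) (primrecPred_forall_lt (primrec_two_pow hN₁) ?_))
    exact primrecPred_imp (primrecPred_testBit (hm₁.comp .fst) .snd) (primrecPred_imp
      (primrecPred_softRelCode I (hN₁.comp .fst) (hs₁.comp .fst) (ht₁.comp .fst) .snd)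
      (primrecPred_testBit .snd (hd₁.comp .fst)))
  · have hc := primrec_pair_pair 4 (groupCode I.1) hd₁
    refine primrecPred_imp (primrecPred_testBit hs₁ hc) (primrecPred_iff
      (primrecPred_testBit ht₁ hc) (primrecPred_forall_lt (primrec_two_pow hN₁) ?_))
    exact primrecPred_imp (primrecPred_testBit (hm₁.comp .fst) .snd) (primrecPred_imp
      (primrecPred_hardRelCode I (hN₁.comp .fst) (hs₁.comp .fst) (ht₁.comp .fst) .snd)
      (primrecPred_testBit .snd (hd₁.comp .fst)))

theorem primrecPred_refutable (hN : Primrec N) (hs : Primrec s) (hk : Primrec k) :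
    PrimrecPred fun x => Refutable S (N x) (s x) (k x) := by
  refine primrecPred_exists_lt (primrec_two_pow (primrec_two_pow hN)) (.and
    (primrecPred_forall_lt (primrec_two_pow (hN.comp .fst)) ?_)
    (primrecPred_exists_lt (primrec_two_pow (hN.comp .fst)) ?_))
  · have h₁ := Primrec.fst.comp (Primrec.fst (α := α × ℕ) (β := ℕ))
    have h₂ := Primrec.snd.comp (Primrec.fst (α := α × ℕ) (β := ℕ))
    exact primrecPred_imp (primrecPred_testBit h₂ .snd)
      (primrecPred_hintikkaAt (hN.comp h₁) (hs.comp h₁) h₂ .snd)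
  · exact (primrecPred_testBit (Primrec.snd.comp .fst) .snd).and
      (primrecPred_testBit .snd (hk.comp (Primrec.fst.comp .fst))).not

end Decidability

theorem decidableLogic_logic [Primcodable Atom] : DecidableLogic (logic.{u, v} S Atom) := by
  have hN := Primrec.succ.comp (Primrec.fst (α := ℕ) (β := ℕ))
  have hp : PrimrecPred fun k : ℕ => ∃ s < 2 ^ (k + 1),
      IsCodeMask S Atom (k + 1) s ∧ s.testBit k ∧ ¬ Refutable S (k + 1) s k :=
    primrecPred_exists_lt (primrec_two_pow .succ) ((primrecPred_isCodeMask hN .snd).and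
      ((primrecPred_testBit .snd .fst).and (primrecPred_refutable hN .snd .fst).not))
  refine hp.computablePred.of_eq fun k => ?_
  constructor
  · rintro ⟨s, -, hs, hk, href⟩
    obtain ⟨hlt, φ, rfl⟩ := hs.testBit_iff.1 hk
    refine ⟨φ, Provable.valid ?_, rfl⟩
    by_contra hφ
    exact href (hs.refutable hlt hφ)
  · rintro ⟨φ, hφ, rfl⟩
    obtain ⟨s, hs⟩ := exists_isCodeMask S Atom (φ.code + 1)
    have hlt := Nat.lt_succ_self φ.code
    exact ⟨s, hs.1, hs, hs.testBit_iff.2 ⟨hlt, φ, rfl⟩, fun href => hs.not_valid hlt href hφ⟩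

end GroupEvidence

theorem theorem6 (n : ℕ) (Atom : Type v) [Countable Atom] :
    -- the full language
    ((∀ φ : GroupEvidence.Formula (GroupEvidence.allGroups n) Atom,
        GroupEvidence.Provable φ ↔ GroupEvidence.Valid.{u, v} φ) ∧
      (∀ [Primcodable Atom], GroupEvidence.DecidableLogic
        (GroupEvidence.logic.{u, v} (GroupEvidence.allGroups n) Atom))) ∧
    -- the fragment with individual agents and the full group
    ((∀ φ : GroupEvidence.Formula (GroupEvidence.individualsAndFull n) Atom,
        GroupEvidence.Provable φ ↔ GroupEvidence.Valid.{u, v} φ) ∧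
      (∀ [Primcodable Atom], GroupEvidence.DecidableLogic
        (GroupEvidence.logic.{u, v} (GroupEvidence.individualsAndFull n) Atom))) := by
  exact ⟨⟨GroupEvidence.provable_iff_valid, GroupEvidence.decidableLogic_logic⟩,
    GroupEvidence.provable_iff_valid, GroupEvidence.decidableLogic_logic⟩
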